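/- Let $X$ be a compact Hausdorff space that is homogeneous, i.e. for all $x,y\in X$ there is a homeomorphism $h:X\to X$ with $h(x)=y$. Then $$d(X)\le 2^{wt(X)}.$$ Here $d(X)$ is the least cardinality of a dense subset of $X$. The weak tightness $wt(X)$ is the least infinite cardinal $\kappa$ for which there is a cover $\mathcal C$ of $X$ by subsets of $X$ such that $|\mathcal C|\le 2^\kappa$ and, for all $C\in\mathcal C$: (a) the subspace $C$ has tightness $t(C)\le\kappa$; (b) every point of $X$ lies in $\overline{B}$ for some $B\subseteq C$ with $|B|\le 2^\kappa$, the closure being taken in $X$. The tightness $t(Y)$ of a space $Y$ is the least infinite cardinal $\lambda$ such that, whenever $A\subseteq Y$ and $y\in\overline{A}$, there is $B\subseteq A$ with $|B|\le\lambda$ and $y\in\overline{B}$. -/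

import Mathlib

universe u

namespace TopCard

open Cardinal

/-- The density `d(X)`: the least cardinality of a dense subset of `X`. -/
noncomputable def density (X : Type u) [TopologicalSpace X] : Cardinal.{u} :=
  sInf {κ : Cardinal.{u} | ∃ D : Set X, Dense D ∧ #D = κ}

/-- The tightness `t(X)`: the least infinite cardinal `κ` such that every point in the closure
of a set `A` is in the closure of some subset of `A` of cardinality at most `κ`. -/
noncomputable def tightness (X : Type u) [TopologicalSpace X] : Cardinal.{u} :=
  sInf {κ : Cardinal.{u} | ℵ₀ ≤ κ ∧ ∀ (A : Set X) (x : X), x ∈ closure A →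
    ∃ B : Set X, B ⊆ A ∧ #B ≤ κ ∧ x ∈ closure B}

/-- The `κ`-closure of `A`: the union of the closures of the subsets of `A` of cardinality
at most `κ`. -/
def kClosure {X : Type u} [TopologicalSpace X] (κ : Cardinal.{u}) (A : Set X) : Set X :=
  {x | ∃ B : Set X, B ⊆ A ∧ #B ≤ κ ∧ x ∈ closure B}

/-- `𝒞` is a cover of `X` by at most `2 ^ κ` sets, each of which has tightness at most `κ` in
its subspace topology and has `2 ^ κ`-closure equal to `X`. -/
def IsWeakTightnessCover {X : Type u} [TopologicalSpace X] (κ : Cardinal.{u})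
    (𝒞 : Set (Set X)) : Prop :=
  ⋃₀ 𝒞 = Set.univ ∧ #𝒞 ≤ 2 ^ κ ∧
    ∀ C ∈ 𝒞, tightness C ≤ κ ∧ kClosure (2 ^ κ) C = Set.univ

/-- The weak tightness `wt(X)`: the least infinite cardinal `κ` for which a cover as in
`IsWeakTightnessCover` exists. -/
noncomputable def weakTightness (X : Type u) [TopologicalSpace X] : Cardinal.{u} :=
  sInf {κ : Cardinal.{u} | ℵ₀ ≤ κ ∧ ∃ 𝒞 : Set (Set X), IsWeakTightnessCover κ 𝒞}

/-- A space is homogeneous if any point can be moved to any other by a self-homeomorphism. -/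
def IsHomogeneous (X : Type u) [TopologicalSpace X] : Prop :=
  ∀ x y : X, ∃ h : X ≃ₜ X, h x = y

end TopCard

namespace TopCard

open Set
open scoped Cardinal
open Cardinal hiding univ

universe v

/-! Let κ = wt(X). Each point has a hull of size at most 2^κ such that unions of hulls behave as if
the tightness were at most κ: such a union A meets every member C of the cover in a set dense in A,
so a limit point lying in C is reached from A ∩ C using t(C) ≤ κ (`exists_hull`). With compactness
this has two consequences. A free-sequence argument of length κ⁺ yields a nonempty G_κ set G inside
the closure of some H with |H| ≤ 2^κ (`exists_isGCard_subset_closure`). A closing-off argument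
reduces any cover by G_κ sets to 2^κ of them (`exists_subcover_isGCard`). By homogeneity the
translates of G cover X. Hence 2^κ of them do, and the matching translates of H have dense union. -/

/-! ### Cardinal arithmetic and closing off -/

theorem two_power_power_self {κ : Cardinal.{v}} (hκ : ℵ₀ ≤ κ) :
    ((2 : Cardinal.{v}) ^ κ) ^ κ = 2 ^ κ := by
  rw [← power_mul, mul_eq_self hκ]

theorem mk_biUnion_le_two_power {ι X : Type v} {κ : Cardinal.{v}} (hκ : ℵ₀ ≤ κ) {s : Set ι}
    {f : ι → Set X} (hs : #s ≤ 2 ^ κ) (hf : ∀ i ∈ s, #(f i) ≤ 2 ^ κ) :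
    #(⋃ i ∈ s, f i) ≤ 2 ^ κ := by
  have hinf : ℵ₀ ≤ (2 : Cardinal.{v}) ^ κ := hκ.trans (cantor κ).le
  refine (mk_biUnion_le _ _).trans ?_
  refine (mul_le_mul' hs (ciSup_le' fun i : s => hf i.1 i.2)).trans ?_
  rw [mul_eq_self hinf]

theorem mk_Iio_le_of_succ {κ : Cardinal.{v}} (a : (Order.succ κ).ord.ToType) :
    #(Iio a) ≤ κ := by
  rw [← Order.lt_succ_iff]
  exact (mk_Iio_lt a (by simp)).trans_eq (by simp)

/-- Regularity of κ⁺: its initial segments have size at most κ, so κ of them cannot exhaust it. -/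
theorem exists_forall_lt_of_mk_le {κ : Cardinal.{v}} (hκ : ℵ₀ ≤ κ) {ι : Type v} (hι : #ι ≤ κ)
    (f : ι → (Order.succ κ).ord.ToType) : ∃ a, ∀ i, f i < a := by
  by_contra! h
  have hcover : (Set.univ : Set (Order.succ κ).ord.ToType) ⊆ ⋃ i, Iic (f i) := fun a _ => by
    obtain ⟨i, hi⟩ := h a
    exact mem_iUnion.2 ⟨i, hi⟩
  have hIic : ∀ a : (Order.succ κ).ord.ToType, #(Iic a) ≤ κ := fun a => by
    rw [← Iio_insert]
    exact mk_insert_le.trans (add_le_of_le hκ (mk_Iio_le_of_succ a)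
      (one_le_aleph0.trans hκ))
  have : Order.succ κ ≤ κ := by
    calc Order.succ κ = #(Set.univ : Set (Order.succ κ).ord.ToType) := by simp
      _ ≤ #(⋃ i, Iic (f i)) := mk_le_mk_of_subset hcover
      _ ≤ #ι * ⨆ i, #(Iic (f i)) := mk_iUnion_le _
      _ ≤ κ * κ := mul_le_mul' hι (ciSup_le' fun i => hIic _)
      _ = κ := mul_eq_self hκ
  exact (Order.lt_succ κ).not_ge this

/-- A set of size at most `2 ^ κ` closed under a set operation of arity at most `κ`. -/
theorem exists_closed_under {X : Type v} {κ : Cardinal.{v}} (hκ : ℵ₀ ≤ κ) (F : Set X → Set X)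
    (hF : ∀ S : Set X, #S ≤ κ → #(F S) ≤ 2 ^ κ) :
    ∃ A : Set X, #A ≤ 2 ^ κ ∧ ∀ S ⊆ A, #S ≤ κ → F S ⊆ A := by
  have hinf : ℵ₀ ≤ (2 : Cardinal.{v}) ^ κ := hκ.trans (cantor κ).le
  let W := (Order.succ κ).ord.ToType
  have hwf : WellFounded ((· < ·) : W → W → Prop) := wellFounded_lt
  obtain ⟨A, hA⟩ : ∃ A : W → Set X, ∀ a,
      A a = ⋃ S ∈ {S : Set X | S ⊆ ⋃ b : Iio a, A b ∧ #S ≤ κ}, F S :=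
    ⟨hwf.fix fun a g => ⋃ S ∈ {S : Set X | S ⊆ ⋃ b : Iio a, g b.1 b.2 ∧ #S ≤ κ}, F S,
      fun a => hwf.fix_eq _ a⟩
  have hcard : ∀ a, #(A a) ≤ 2 ^ κ := fun a => by
    induction a using hwf.induction with
    | _ a ih =>
      rw [hA]
      refine mk_biUnion_le_two_power hκ ?_ fun S hS => hF S hS.2
      have hU : #(⋃ b : Iio a, A b) ≤ 2 ^ κ := by
        refine (mk_iUnion_le _).trans ?_
        refine (mul_le_mul' ((mk_Iio_le_of_succ a).trans (cantor κ).le)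
          (ciSup_le' fun b : Iio a => ih b.1 b.2)).trans ?_
        rw [mul_eq_self hinf]
      refine (mk_bounded_subset_le (⋃ b : Iio a, A b) κ).trans ?_
      exact (power_le_power_right (max_le hU hinf)).trans_eq (two_power_power_self hκ)
  refine ⟨⋃ a, A a, ?_, fun S hS hSκ => ?_⟩
  · refine (mk_iUnion_le _).trans ?_
    refine (mul_le_mul' (?_ : _ ≤ (2 : Cardinal.{v}) ^ κ) (ciSup_le' hcard)).trans ?_
    · simpa [W] using Order.succ_le_of_lt (cantor κ)
    · rw [mul_eq_self hinf]
  -- By regularity of κ⁺, all of S has appeared before some stage a, which then adds F S.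
  · choose r hr using fun s : S => mem_iUnion.1 (hS s.2)
    obtain ⟨a, ha⟩ := exists_forall_lt_of_mk_le hκ hSκ r
    refine Subset.trans ?_ (subset_iUnion A a)
    rw [hA a]
    exact subset_biUnion_of_mem (u := F)
      (⟨fun s hs => mem_iUnion.2 ⟨⟨r ⟨s, hs⟩, ha ⟨s, hs⟩⟩, hr ⟨s, hs⟩⟩, hSκ⟩ :
        S ∈ {S : Set X | S ⊆ ⋃ b : Iio a, A b ∧ #S ≤ κ})

/-! ### Tightness and hulls -/

variable {X : Type v} [TopologicalSpace X]

theorem exists_subset_of_tightness_le {κ : Cardinal.{v}} {C : Set X} (hC : tightness C ≤ κ)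
    {A : Set X} (hAC : A ⊆ C) {x : X} (hxC : x ∈ C) (hx : x ∈ closure A) :
    ∃ B ⊆ A, #B ≤ κ ∧ x ∈ closure B := by
  have hne : {κ : Cardinal.{v} | ℵ₀ ≤ κ ∧ ∀ (A : Set C) (x : C), x ∈ closure A →
      ∃ B : Set C, B ⊆ A ∧ #B ≤ κ ∧ x ∈ closure B}.Nonempty :=
    ⟨max ℵ₀ #C, le_max_left _ _, fun A x hx =>
      ⟨A, Subset.rfl, (mk_set_le A).trans (le_max_right _ _), hx⟩⟩
  obtain ⟨-, h⟩ := csInf_mem hne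
  have himage : ((↑) : C → X) '' ((↑) ⁻¹' A) = A := by
    rw [Subtype.image_preimage_coe, inter_eq_right.2 hAC]
  obtain ⟨B, hBA, hBκ, hxB⟩ := h ((↑) ⁻¹' A) ⟨x, hxC⟩ (by
    rwa [closure_subtype, himage])
  refine ⟨(↑) '' B, ?_, mk_image_le.trans (hBκ.trans hC), closure_subtype.1 hxB⟩
  rintro _ ⟨b, hb, rfl⟩
  exact hBA hb

/-- The weak tightness is witnessed by a cover. -/
theorem exists_isWeakTightnessCover (X : Type v) [TopologicalSpace X] :
    ℵ₀ ≤ weakTightness X ∧ ∃ 𝒞 : Set (Set X), IsWeakTightnessCover (weakTightness X) 𝒞 := by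
  refine csInf_mem (s := {κ : Cardinal.{v} | ℵ₀ ≤ κ ∧
    ∃ 𝒞 : Set (Set X), IsWeakTightnessCover κ 𝒞}) ⟨max ℵ₀ #X, le_max_left _ _, {univ}, ?_⟩
  have hinf : max ℵ₀ #X < 2 ^ max ℵ₀ #X := cantor _
  refine ⟨sUnion_singleton _, ?_, ?_⟩
  · rw [mk_singleton]
    exact (one_le_aleph0.trans (le_max_left _ _)).trans hinf.le
  · rintro C rfl
    refine ⟨csInf_le' ⟨le_max_left _ _, fun A x hx => ⟨A, Subset.rfl, ?_, hx⟩⟩, ?_⟩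
    · exact (mk_set_le A).trans (mk_univ.le.trans (le_max_right _ _))
    · refine eq_univ_of_forall fun x => ⟨univ, Subset.rfl, ?_, subset_closure (mem_univ x)⟩
      exact mk_univ.le.trans ((le_max_right _ _).trans hinf.le)

/-- Points have hulls of size at most `2 ^ κ` such that each point in the closure of a union of
hulls is in the closure of a subset of that union of size at most `κ`. -/
theorem IsWeakTightnessCover.exists_hull {κ : Cardinal.{v}} (hκ : ℵ₀ ≤ κ) {𝒞 : Set (Set X)}
    (h𝒞 : IsWeakTightnessCover κ 𝒞) :
    ∃ φ : X → Set X, (∀ x, x ∈ φ x) ∧ (∀ x, #(φ x) ≤ 2 ^ κ) ∧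
      ∀ (S : Set X) (y : X), y ∈ closure (⋃ s ∈ S, φ s) →
        ∃ B ⊆ ⋃ s ∈ S, φ s, #B ≤ κ ∧ y ∈ closure B := by
  obtain ⟨hcov, hcard, h⟩ := h𝒞
  have hpick : ∀ (x : X) (C : Set X), ∃ B : Set X, C ∈ 𝒞 →
      B ⊆ C ∧ #B ≤ 2 ^ κ ∧ x ∈ closure B := fun x C => by
    by_cases hC : C ∈ 𝒞
    · obtain ⟨B, hB⟩ : x ∈ kClosure (2 ^ κ) C := by rw [(h C hC).2]; trivial
      exact ⟨B, fun _ => hB⟩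
    · exact ⟨∅, fun hC' => absurd hC' hC⟩
  choose P hP using hpick
  let F : Set X → Set X := fun S => ⋃ x ∈ S, ⋃ C ∈ 𝒞, P x C
  have hF : ∀ S : Set X, #S ≤ 2 ^ κ → #(F S) ≤ 2 ^ κ := fun S hS =>
    mk_biUnion_le_two_power hκ hS fun x _ =>
      mk_biUnion_le_two_power hκ hcard fun C hC => (hP x C hC).2.1
  have hone : (1 : Cardinal.{v}) ≤ 2 ^ κ := (one_le_aleph0.trans hκ).trans (cantor κ).le
  have hit : ∀ (x : X) (n : ℕ), #(F^[n] {x} : Set X) ≤ 2 ^ κ := fun x n => by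
    induction n with
    | zero => simpa using hone
    | succ n ih =>
      rw [Function.iterate_succ_apply']
      exact hF _ ih
  refine ⟨fun x => ⋃ n : ℕ, F^[n] {x}, fun x => mem_iUnion.2 ⟨0, rfl⟩, fun x => ?_,
    fun S y hy => ?_⟩
  · have := mk_biUnion_le_two_power hκ (s := (univ : Set (ULift.{v} ℕ)))
      (f := fun n => F^[n.down] {x})
      (mk_univ.le.trans (by simpa using hκ.trans (cantor κ).le)) fun n _ => hit x n.down
    refine (mk_le_mk_of_subset ?_).trans this
    exact iUnion_subset fun n => subset_biUnion_of_mem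
      (u := fun n : ULift.{v} ℕ => (F^[n.down] {x} : Set X)) (mem_univ (ULift.up n))
  · set A : Set X := ⋃ s ∈ S, ⋃ n : ℕ, F^[n] {s} with hA
    obtain ⟨C, hC, hyC⟩ : y ∈ ⋃₀ 𝒞 := hcov ▸ mem_univ y
    -- A point a of A enters at some stage n. The set `P a C` enters at stage n + 1, lies in C and
    -- accumulates at a.
    have hsat : A ⊆ closure (A ∩ C) := fun a ha => by
      simp only [hA, mem_iUnion] at ha
      obtain ⟨s, hs, n, hn⟩ := ha
      refine closure_mono (subset_inter (fun b hb => ?_) (hP a C hC).1) (hP a C hC).2.2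
      simp only [hA, mem_iUnion]
      refine ⟨s, hs, n + 1, ?_⟩
      rw [Function.iterate_succ_apply']
      exact mem_biUnion hn (mem_biUnion hC hb)
    obtain ⟨B, hBA, hB⟩ := exists_subset_of_tightness_le (h C hC).1 inter_subset_right hyC
      (closure_minimal hsat isClosed_closure hy)
    exact ⟨B, hBA.trans inter_subset_left, hB⟩

/-! ### G_κ sets and the free-sequence argument -/

/-- Intersections of at most `κ` open sets. -/
def IsGCard (κ : Cardinal.{v}) (G : Set X) : Prop :=
  ∃ 𝒰 : Set (Set X), (∀ U ∈ 𝒰, IsOpen U) ∧ #𝒰 ≤ κ ∧ ⋂₀ 𝒰 = G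

theorem IsGCard.iInter {κ : Cardinal.{v}} (hκ : ℵ₀ ≤ κ) {ι : Type v} (hι : #ι ≤ κ)
    {G : ι → Set X} (hG : ∀ i, IsGCard κ (G i)) : IsGCard κ (⋂ i, G i) := by
  choose 𝒰 hopen hcard heq using hG
  refine ⟨⋃ i, 𝒰 i, fun U hU => ?_, ?_, ?_⟩
  · obtain ⟨i, hi⟩ := mem_iUnion.1 hU
    exact hopen i U hi
  · refine (mk_iUnion_le _).trans ?_
    refine (mul_le_mul' hι (ciSup_le' hcard)).trans ?_
    rw [mul_eq_self hκ]
  · rw [sInter_iUnion]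
    exact iInter_congr heq

theorem _root_.IsGδ.isGCard {κ : Cardinal.{v}} (hκ : ℵ₀ ≤ κ) {G : Set X} (hG : IsGδ G) :
    IsGCard κ G := by
  obtain ⟨T, hT, hcount, rfl⟩ := hG
  exact ⟨T, hT, (mk_le_aleph0_iff.2 hcount.to_subtype).trans hκ, rfl⟩

/-- A point outside a closed set has a closed `Gδ` neighbourhood avoiding that set. -/
theorem exists_isClosed_isGδ_disjoint [NormalSpace X] [T1Space X] {K : Set X} (hK : IsClosed K)
    {x : X} (hx : x ∉ K) : ∃ Z : Set X, IsClosed Z ∧ IsGδ Z ∧ x ∈ Z ∧ Disjoint Z K := by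
  obtain ⟨f, hf0, hf1, -⟩ := exists_continuous_zero_one_of_isClosed (isClosed_singleton (x := x))
    hK (disjoint_singleton_left.2 hx)
  have hc : IsClosed (f ⁻¹' {0}) := isClosed_singleton.preimage f.continuous
  refine ⟨f ⁻¹' {0}, hc, ?_, hf0 rfl, ?_⟩
  · exact (isClosed_singleton (x := (0 : ℝ))).isGδ.preimage f.continuous
  · refine disjoint_left.2 fun y hy hyK => ?_
    have h1 := hf1 hyK
    rw [mem_preimage, mem_singleton_iff] at hy
    simp [hy] at h1

/-- A compact space contains a nonempty intersection of at most `κ` open sets that lies in the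
closure of a set of size at most `2 ^ κ`. -/
theorem exists_isGCard_subset_closure [CompactSpace X] [T2Space X] [Nonempty X]
    {κ : Cardinal.{v}} (hκ : ℵ₀ ≤ κ) {φ : X → Set X} (hmem : ∀ x, x ∈ φ x)
    (hcard : ∀ x, #(φ x) ≤ 2 ^ κ)
    (hφ : ∀ (S : Set X) (y : X), y ∈ closure (⋃ s ∈ S, φ s) →
      ∃ B ⊆ ⋃ s ∈ S, φ s, #B ≤ κ ∧ y ∈ closure B) :
    ∃ G H : Set X, G.Nonempty ∧ IsGCard κ G ∧ #H ≤ 2 ^ κ ∧ G ⊆ closure H := by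
  by_contra! hcon
  let W := (Order.succ κ).ord.ToType
  have hwf : WellFounded ((· < ·) : W → W → Prop) := wellFounded_lt
  let Φ : Set X → Set X := fun S => ⋃ s ∈ S, φ s
  -- A stage picks a point in all earlier closed sets, and a closed Gδ set that meets their
  -- intersection but misses the closure of the hulls chosen so far.
  let Good : ∀ a : W, (∀ b : W, b < a → X × Set X) → X × Set X → Prop := fun a g p =>
    p.1 ∈ (⋂ b : Iio a, (g b.1 b.2).2) ∧ IsClosed p.2 ∧ IsGδ p.2 ∧
      ((⋂ b : Iio a, (g b.1 b.2).2) ∩ p.2).Nonempty ∧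
      Disjoint p.2 (closure (Φ (insert p.1 (range fun b : Iio a => (g b.1 b.2).1))))
  classical
  let f : W → X × Set X := hwf.fix fun a g =>
    if h : ∃ p, Good a g p then h.choose else (Classical.arbitrary X, univ)
  have hstep : ∀ a, (∃ p, Good a (fun b _ => f b) p) → Good a (fun b _ => f b) (f a) := by
    intro a h
    have : f a = h.choose := by
      change hwf.fix _ a = _
      rw [hwf.fix_eq]
      exact dif_pos h
    rw [this]
    exact h.choose_spec
  have hgood : ∀ a, Good a (fun b _ => f b) (f a) := fun a => by
    induction a using hwf.induction with
    | _ a ih =>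
      apply hstep
      have hne : (⋂ b : Iio a, (f b).2).Nonempty := by
        rcases isEmpty_or_nonempty (Iio a) with he | he
        · rw [iInter_of_empty]; exact univ_nonempty
        · have hcl : ∀ b : Iio a, IsClosed ((⋂ c : Iio b.1, (f c).2) ∩ (f b).2) := fun b =>
            (isClosed_iInter fun c : Iio b.1 => (ih c (c.2.trans b.2)).2.1).inter (ih b b.2).2.1
          have hmono : ∀ b c : Iio a, b ≤ c → (⋂ d : Iio c.1, (f d).2) ∩ (f c).2 ⊆
              (⋂ d : Iio b.1, (f d).2) ∩ (f b).2 := fun b c hbc => by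
            rcases hbc.eq_or_lt with rfl | hlt
            · exact Subset.rfl
            · refine fun y hy => ⟨mem_iInter.2 fun d => ?_, mem_iInter.1 hy.1 ⟨b.1, hlt⟩⟩
              exact mem_iInter.1 hy.1 ⟨d.1, lt_trans (mem_Iio.1 d.2) hlt⟩
          obtain ⟨y, hy⟩ := IsCompact.nonempty_iInter_of_directed_nonempty_isCompact_isClosed
            (fun b : Iio a => (⋂ c : Iio b.1, (f c).2) ∩ (f b).2)
            (fun b c => ⟨max b c, hmono _ _ (le_max_left _ _), hmono _ _ (le_max_right _ _)⟩)
            (fun b => (ih b b.2).2.2.2.1) (fun b => (hcl b).isCompact) hcl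
          exact ⟨y, mem_iInter.2 fun b => (mem_iInter.1 hy b).2⟩
      have hG : IsGCard κ (⋂ b : Iio a, (f b).2) :=
        IsGCard.iInter hκ (mk_Iio_le_of_succ a) fun b => (ih b b.2).2.2.1.isGCard hκ
      obtain ⟨x, hx⟩ := hne
      have hH : #(Φ (insert x (range fun b : Iio a => (f b).1))) ≤ 2 ^ κ := by
        refine mk_biUnion_le_two_power hκ ?_ fun i _ => hcard i
        refine (mk_insert_le.trans (add_le_of_le hκ ?_ (one_le_aleph0.trans hκ))).trans
          (cantor κ).le
        exact mk_range_le.trans (mk_Iio_le_of_succ a)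
      obtain ⟨y, hyG, hy⟩ := not_subset.1 (hcon _ _ ⟨x, hx⟩ hG hH)
      obtain ⟨Z, hZc, hZδ, hyZ, hZ⟩ := exists_isClosed_isGδ_disjoint isClosed_closure hy
      exact ⟨(x, Z), hx, hZc, hZδ, ⟨y, hyG, hyZ⟩, hZ⟩
  have hpt : ∀ a b : W, b < a → (f a).1 ∈ (f b).2 := fun a b hba =>
    mem_iInter.1 (hgood a).1 ⟨b, hba⟩
  have hnoMax : ∀ a : W, ∃ b, a < b := fun a => by
    obtain ⟨b, hb⟩ := exists_forall_lt_of_mk_le hκ (ι := PUnit.{v + 1})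
      (by simpa using one_le_aleph0.trans hκ) fun _ => a
    exact ⟨b, hb ⟨⟩⟩
  -- Compactness gives y in K and in every closed set chosen. Then y is a limit of at most κ hull
  -- points, all from stages below some a, contradicting the disjointness at stage a.
  let K : Set X := closure (Φ (range fun a => (f a).1))
  have hne : Nonempty W := by
    obtain ⟨b, -⟩ := exists_forall_lt_of_mk_le hκ (ι := PEmpty.{v + 1}) (by simp) nofun
    exact ⟨b⟩
  have hcl : ∀ a : W, IsClosed (K ∩ ⋂ b : Iic a, (f b).2) := fun a =>
    isClosed_closure.inter (isClosed_iInter fun b => (hgood b).2.1)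
  have hmono : ∀ a b : W, a ≤ b → K ∩ (⋂ c : Iic b, (f c).2) ⊆ K ∩ ⋂ c : Iic a, (f c).2 :=
    fun a b hab y hy => ⟨hy.1, mem_iInter.2 fun c => mem_iInter.1 hy.2 ⟨c, le_trans (mem_Iic.1 c.2) hab⟩⟩
  obtain ⟨y, hy⟩ := IsCompact.nonempty_iInter_of_directed_nonempty_isCompact_isClosed
    (fun a : W => K ∩ ⋂ b : Iic a, (f b).2)
    (fun b c => ⟨max b c, hmono _ _ (le_max_left _ _), hmono _ _ (le_max_right _ _)⟩)
    (fun a => by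
      obtain ⟨b, hb⟩ := hnoMax a
      exact ⟨(f b).1, subset_closure (mem_biUnion (mem_range_self b) (hmem _)),
        mem_iInter.2 fun c => hpt b c (lt_of_le_of_lt c.2 hb)⟩)
    (fun a => (hcl a).isCompact) hcl
  rw [mem_iInter] at hy
  obtain ⟨B, hBK, hBκ, hyB⟩ := hφ _ y (hy hne.some).1
  have hB : ∀ b : B, ∃ a : W, b.1 ∈ φ (f a).1 := fun b => by
    obtain ⟨_, ⟨a, rfl⟩, hb⟩ := mem_iUnion₂.1 (hBK b.2)
    exact ⟨a, hb⟩
  choose r hr using hB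
  obtain ⟨a, ha⟩ := exists_forall_lt_of_mk_le hκ hBκ r
  refine disjoint_left.1 (hgood a).2.2.2.2 (mem_iInter.1 (hy a).2 ⟨a, self_mem_Iic⟩)
    (closure_mono (fun b hb => ?_) hyB)
  exact mem_biUnion (mem_insert_of_mem _ ⟨⟨r ⟨b, hb⟩, ha _⟩, rfl⟩) (hr ⟨b, hb⟩)

/-! ### Covers by G_κ sets -/

/-- The closure of a set of size at most `κ` is covered by at most `2 ^ κ` members of any
neighbourhood assignment by intersections of at most `κ` open sets. -/
theorem exists_cover_closure [RegularSpace X] {κ : Cardinal.{v}} (hκ : ℵ₀ ≤ κ)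
    {G : X → Set X} (hmem : ∀ x, x ∈ G x) (hG : ∀ x, IsGCard κ (G x)) {B : Set X}
    (hB : #B ≤ κ) : ∃ T : Set X, #T ≤ 2 ^ κ ∧ closure B ⊆ ⋃ t ∈ T, G t := by
  classical
  have hinf : ℵ₀ ≤ (2 : Cardinal.{v}) ^ κ := hκ.trans (cantor κ).le
  -- Regularity puts some ⋂ closure D, with D ranging over a family in 𝔇, between x and `G x`. One
  -- index per family suffices, even if it is not x itself.
  let 𝔇 : Set (Set (Set X)) := {𝒟 | 𝒟 ⊆ 𝒫 B ∧ #𝒟 ≤ κ}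
  have h𝔇 : #𝔇 ≤ 2 ^ κ := by
    refine (mk_bounded_subset_le (𝒫 B) κ).trans ?_
    rw [mk_powerset]
    exact (power_le_power_right (max_le (power_le_power_left two_ne_zero hB) hinf)).trans_eq
      (two_power_power_self hκ)
  have hpick : ∀ 𝒟 : Set (Set X), ∃ T : Set X, #T ≤ 1 ∧
      ((∃ x, ⋂ D ∈ 𝒟, closure D ⊆ G x) → ∃ x ∈ T, ⋂ D ∈ 𝒟, closure D ⊆ G x) := fun 𝒟 => by
    by_cases h : ∃ x, ⋂ D ∈ 𝒟, closure D ⊆ G x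
    · obtain ⟨x, hx⟩ := h
      exact ⟨{x}, (mk_singleton x).le, fun _ => ⟨x, rfl, hx⟩⟩
    · exact ⟨∅, by simp, fun h' => absurd h' h⟩
  choose T hT1 hT using hpick
  refine ⟨⋃ 𝒟 ∈ 𝔇, T 𝒟, mk_biUnion_le_two_power hκ h𝔇 fun 𝒟 _ =>
    (hT1 𝒟).trans (one_le_aleph0.trans hinf), fun x hx => ?_⟩
  obtain ⟨𝒰, hopen, h𝒰, heq⟩ := hG x
  have hnet : ∀ U : 𝒰, ∃ D ⊆ B, x ∈ closure D ∧ closure D ⊆ U := fun U => by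
    have hxU : x ∈ U.1 := by
      have := hmem x
      rw [← heq] at this
      exact this U U.2
    obtain ⟨V, hV, hVc, hVU⟩ := exists_mem_nhds_isClosed_subset ((hopen U U.2).mem_nhds hxU)
    exact ⟨V ∩ B, inter_subset_right, by
      rw [inter_comm]; exact mem_closure_iff_nhds'.2 fun s hs => by
        obtain ⟨y, hy⟩ := mem_closure_iff_nhds'.1 hx (s ∩ V) (Filter.inter_mem hs hV)
        exact ⟨⟨y, y.2, hy.2⟩, hy.1⟩,
      (closure_minimal inter_subset_left hVc).trans hVU⟩
  choose D hDB hxD hDU using hnet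
  have h𝒟 : range D ∈ 𝔇 :=
    ⟨range_subset_iff.2 hDB, mk_range_le.trans h𝒰⟩
  obtain ⟨t, ht, htG⟩ := hT (range D) ⟨x, by
    rw [← heq]
    exact fun y hy U hU => hDU ⟨U, hU⟩ (mem_iInter₂.1 hy _ (mem_range_self (⟨U, hU⟩ : 𝒰)))⟩
  refine mem_biUnion (mem_biUnion h𝒟 ht) (htG (mem_iInter₂.2 ?_))
  rintro _ ⟨U, rfl⟩
  exact hxD U

/-- In a compact space with suitable hulls, every cover by intersections of at most `κ` open sets
has a subcover of size at most `2 ^ κ`. -/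
theorem exists_subcover_isGCard [CompactSpace X] [T2Space X]
    {κ : Cardinal.{v}} (hκ : ℵ₀ ≤ κ) {φ : X → Set X} (hmem : ∀ x, x ∈ φ x)
    (hcard : ∀ x, #(φ x) ≤ 2 ^ κ)
    (hφ : ∀ (S : Set X) (y : X), y ∈ closure (⋃ s ∈ S, φ s) →
      ∃ B ⊆ ⋃ s ∈ S, φ s, #B ≤ κ ∧ y ∈ closure B)
    {G : X → Set X} (hmemG : ∀ x, x ∈ G x) (hG : ∀ x, IsGCard κ (G x)) :
    ∃ T : Set X, #T ≤ 2 ^ κ ∧ ⋃ t ∈ T, G t = univ := by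
  classical
  have hinf : ℵ₀ ≤ (2 : Cardinal.{v}) ^ κ := hκ.trans (cantor κ).le
  have hcov : ∀ B : Set X, ∃ T : Set X, #B ≤ κ → #T ≤ 2 ^ κ ∧ closure B ⊆ ⋃ t ∈ T, G t :=
    fun B => by
      by_cases hB : #B ≤ κ
      · obtain ⟨T, hT⟩ := exists_cover_closure hκ hmemG hG hB
        exact ⟨T, fun _ => hT⟩
      · exact ⟨∅, fun h => absurd h hB⟩
  choose I hI using hcov
  choose 𝒰 hopen h𝒰 heq using hG
  have hpick : ∀ w : Finset (Set X), ∃ Q : Set X, #Q ≤ 1 ∧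
      ((∃ p, p ∉ ⋃ U ∈ w, U) → ∃ p ∈ Q, p ∉ ⋃ U ∈ w, U) := fun w => by
    by_cases h : ∃ p, p ∉ ⋃ U ∈ w, U
    · obtain ⟨p, hp⟩ := h
      exact ⟨{p}, (mk_singleton p).le, fun _ => ⟨p, mem_singleton p, hp⟩⟩
    · exact ⟨∅, by simp, fun h' => absurd h' h⟩
  choose Q hQ1 hQ using hpick
  let 𝒲 : Set X → Set (Finset (Set X)) := fun S => {w | (w : Set (Set X)) ⊆ ⋃ x ∈ S, 𝒰 x}
  have h𝒲 : ∀ S : Set X, #S ≤ κ → #(𝒲 S) ≤ 2 ^ κ := fun S hS => by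
    have h1 : #(⋃ x ∈ S, 𝒰 x) ≤ 2 ^ κ := mk_biUnion_le_two_power hκ (hS.trans (cantor κ).le)
      fun x _ => (h𝒰 x).trans (cantor κ).le
    have h2 : #(𝒲 S) ≤ #{t : Set (Set X) // t ⊆ ⋃ x ∈ S, 𝒰 x ∧ #t ≤ κ} :=
      mk_le_of_injective (f := fun w => ⟨(w.1 : Set (Set X)), w.2,
        (mk_le_aleph0_iff.2 (Finset.countable_toSet w.1).to_subtype).trans hκ⟩)
        fun w w' h => Subtype.ext (Finset.coe_injective (congrArg Subtype.val h))
    refine (h2.trans (mk_bounded_subset_le _ κ)).trans ?_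
    exact (power_le_power_right (max_le h1 hinf)).trans_eq (two_power_power_self hκ)
  -- A absorbs hulls, the indices covering closures of its small subsets, and a point outside each
  -- non-covering finite family of open sets indexed by A.
  obtain ⟨A, hA, hclosed⟩ := exists_closed_under hκ
    (fun S : Set X => (⋃ x ∈ S, φ x) ∪ (I S ∪ ⋃ w ∈ 𝒲 S, Q w)) fun S hS => by
      refine (mk_union_le _ _).trans (add_le_of_le hinf ?_
        ((mk_union_le _ _).trans (add_le_of_le hinf (hI S hS).1 ?_)))
      · exact mk_biUnion_le_two_power hκ (hS.trans (cantor κ).le) fun x _ => hcard x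
      · exact mk_biUnion_le_two_power hκ (h𝒲 S hS) fun w _ =>
          (hQ1 w).trans (one_le_aleph0.trans hinf)
  have hAφ : ⋃ s ∈ A, φ s = A := by
    refine Subset.antisymm (iUnion₂_subset fun s hs => ?_) fun s hs => mem_biUnion hs (hmem s)
    refine Subset.trans ?_ (hclosed {s} (singleton_subset_iff.2 hs)
      ((mk_singleton s).le.trans (one_le_aleph0.trans hκ)))
    refine Subset.trans ?_ subset_union_left
    exact subset_biUnion_of_mem (u := φ) (mem_singleton s)
  have hclA : closure A ⊆ ⋃ t ∈ A, G t := fun y hy => by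
    obtain ⟨B, hBA, hBκ, hyB⟩ := hφ A y (by rwa [hAφ])
    rw [hAφ] at hBA
    obtain ⟨t, ht, hyt⟩ := mem_iUnion₂.1 ((hI B hBκ).2 hyB)
    exact mem_biUnion (hclosed B hBA hBκ (Or.inr (Or.inl ht))) hyt
  refine ⟨A, hA, eq_univ_of_forall fun p => ?_⟩
  by_contra hp
  -- If p were uncovered, finitely many of these open sets, all missing p, would cover closure A.
  -- But A already contains a point outside their union.
  have hsep : ∀ y ∈ closure A, ∃ x ∈ A, ∃ U ∈ 𝒰 x, y ∈ U ∧ p ∉ U := fun y hy => by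
    obtain ⟨x, hx, hyx⟩ := mem_iUnion₂.1 (hclA hy)
    have hpx : p ∉ ⋂₀ 𝒰 x := fun h => hp (mem_biUnion hx (heq x ▸ h))
    rw [← heq x] at hyx
    rw [mem_sInter] at hpx
    push Not at hpx
    obtain ⟨U, hU, hpU⟩ := hpx
    exact ⟨x, hx, U, hU, hyx U hU, hpU⟩
  choose! x hxA U hU hyU hpU using hsep
  obtain ⟨F, hF, hcover⟩ := isClosed_closure.isCompact.elim_nhds_subcover U fun y hy =>
    (hopen _ _ (hU y hy)).mem_nhds (hyU y hy)
  let w : Finset (Set X) := F.image U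
  have hw : ∃ q ∈ Q w, q ∉ ⋃ U ∈ w, U := hQ w ⟨p, by
    simp only [w, mem_iUnion, Finset.mem_image, not_exists]
    rintro _ ⟨y, hy, rfl⟩
    exact hpU y (hF y hy)⟩
  obtain ⟨q, hqQ, hq⟩ := hw
  have hS : #(F.image x : Set X) ≤ κ :=
    (mk_le_aleph0_iff.2 (Finset.countable_toSet _).to_subtype).trans hκ
  have hwS : w ∈ 𝒲 (F.image x : Set X) := fun V hV => by
    obtain ⟨y, hy, rfl⟩ := Finset.mem_image.1 hV
    exact mem_biUnion (Finset.mem_image_of_mem x hy) (hU y (hF y hy))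
  have hqA : q ∈ A := hclosed _ (fun z hz => by
    obtain ⟨y, hy, rfl⟩ := Finset.mem_image.1 hz
    exact hxA y (hF y hy)) hS (Or.inr (Or.inr (mem_biUnion hwS hqQ)))
  obtain ⟨y, hy, hqy⟩ := mem_iUnion₂.1 (hcover (subset_closure hqA))
  exact hq (mem_biUnion (Finset.mem_image_of_mem U hy) hqy)

/-! ### Translation by homogeneity -/

theorem IsGCard.preimage {Y : Type v} [TopologicalSpace Y] {κ : Cardinal.{v}} {G : Set Y}
    (hG : IsGCard κ G) {f : X → Y} (hf : Continuous f) : IsGCard κ (f ⁻¹' G) := by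
  obtain ⟨𝒰, hopen, hcard, rfl⟩ := hG
  refine ⟨Set.preimage f '' 𝒰, ?_, mk_image_le.trans hcard, ?_⟩
  · rintro _ ⟨U, hU, rfl⟩
    exact (hopen U hU).preimage hf
  · rw [sInter_image, preimage_sInter]

end TopCard

open TopCard Set in
open scoped Cardinal in
open Cardinal hiding univ in
theorem theorem3p5 (X : Type u) [TopologicalSpace X] [CompactSpace X] [T2Space X]
    (hX : TopCard.IsHomogeneous X) :
    TopCard.density X ≤ 2 ^ TopCard.weakTightness X := by
  obtain ⟨hκ, 𝒞, h𝒞⟩ := exists_isWeakTightnessCover X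
  suffices h : ∃ D : Set X, Dense D ∧ #D ≤ 2 ^ weakTightness X by
    obtain ⟨D, hD, hcard⟩ := h
    have hmem : #D ∈ {κ | ∃ D : Set X, Dense D ∧ #D = κ} := ⟨D, hD, rfl⟩
    exact (csInf_le' hmem).trans hcard
  rcases isEmpty_or_nonempty X with hempty | hne
  · exact ⟨∅, fun x => hempty.elim x, by simp⟩
  obtain ⟨φ, hmem, hcard, hφ⟩ := h𝒞.exists_hull hκ
  obtain ⟨G, H, ⟨g, hg⟩, hG, hH, hGH⟩ := exists_isGCard_subset_closure hκ hmem hcard hφ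
  choose h hh using hX g
  -- Since `h x` sends g to x, its image of G, written as a preimage under the inverse, is a G_κ set
  -- containing x.
  obtain ⟨T, hT, hcover⟩ := exists_subcover_isGCard hκ hmem hcard hφ
    (G := fun x => (h x).symm ⁻¹' G)
    (fun x => by rwa [mem_preimage, (h x).symm_apply_eq.2 (hh x).symm])
    (fun x => hG.preimage (h x).symm.continuous)
  refine ⟨⋃ t ∈ T, h t '' H, fun x => ?_,
    mk_biUnion_le_two_power hκ hT fun t _ => mk_image_le.trans hH⟩
  obtain ⟨t, ht, hxt⟩ := mem_iUnion₂.1 (hcover.symm ▸ mem_univ x : x ∈ ⋃ t ∈ T, (h t).symm ⁻¹' G)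
  refine closure_mono (subset_biUnion_of_mem (u := fun t => h t '' H) ht) ?_
  rw [← (h t).image_closure]
  exact ⟨(h t).symm x, hGH hxt, (h t).apply_symm_apply x⟩
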